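/- **Setting.** Fix a set $\mathrm{Prop}$ of atoms and a finite set $A$ of agents. Formulas are in negation normal form: $\phi::=\bot\mid\top\mid p\mid\neg p\mid\phi\wedge\phi\mid\phi\vee\phi\mid\Box_a\phi\mid\Diamond_a\phi$ with $p\in\mathrm{Prop}$, $a\in A$. $\mathrm{Var}^+(\phi)$ is the set of atoms $p$ such that the literal $p$ occurs in $\phi$, $\mathrm{Var}^-(\phi)$ the set of those such that $\neg p$ occurs, and $\mathrm{Ag}(\phi)$ the set of agents $a$ such that $\Box_a$ or $\Diamond_a$ occurs. Models $\mathcal M=(W,R,V)$ are Kripke models with $W\neq\varnothing$ and an equivalence relation $R_a$ for every $a\in A$; truth $\mathcal M,w\vDash\phi$ is as usual. **Cross-sequents.** A sequent is a finite set of formulas. A *cross-sequent* is a sequent (its root component) together with finitely many brackets $[H]_a$, $a\in A$, where $H=\mathcal S_1|\dots|\mathcal S_m$ ($m\ge1$) is a multiset of cross-sequents. The roots of $\mathcal S_1,\dots,\mathcal S_m$ are the $a$-children of the component that carries the bracket, which is their $a$-parent, and $a$-siblings of each other. The $a$-cluster of a component consists of it and its $a$-parent, $a$-siblings and $a$-children.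 The depth $d(\mathcal S)$ is the nesting depth of brackets; $d(\mathcal S)=0$ means that $\mathcal S$ is a single sequent. All cross-sequents in a derivation are *proper*: a component has at most one $a$-bracket for each $a$, and a component within an $a$-bracket has no $a$-bracket. **The calculus $\sharp\mathsf{S5}_n$** ($n=|A|$). Rules are applied in an arbitrary context $\mathcal S\{\cdot\}$; principal formulas are kept; read from conclusion to premise(s). - Axioms: a component contains $p$ and $\neg p$; a component contains $\top$. - From $\phi\vee\psi$ in a component, add both $\phi$ and $\psi$ to it; from $\phi\wedge\psi$, two premises, adding $\phi$, respectively $\psi$, to it. - From $\Box_a\phi$ in a component $\Gamma$, create a new component $\{\phi\}$: as another $a$-sibling of $\Gamma$ if $\Gamma$ lies within an $a$-bracket; as another $a$-child of $\Gamma$ if $\Gamma$ has an $a$-bracket; as the first $a$-child of $\Gamma$, in a new bracket, otherwise. - From $\Diamond_a\phi$ in a component $\Gamma$, add $\phi$ to $\Gamma$, or to an $a$-sibling, an $a$-child or the $a$-parent of $\Gamma$. **Splits and interpolants.** A *split* of $\mathcal S$ writes every component as $\Gamma;\Delta$ with $\Gamma\cup\Delta$ the component ($\Gamma$ and $\Delta$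 may overlap); $L(\mathcal S)$ and $R(\mathcal S)$ keep only the left, respectively right, parts. Components carry distinct natural numbers as labels, the root having label $0$. $\mathrm{Var}^\pm$ and $\mathrm{Ag}$ of a cross-sequent are the unions over all formulas in its components. An *interpretation* $f$ into $\mathcal M$ maps the labels to worlds so that $f(k)\,R_a\,f(l)$ whenever the component labelled $l$ is in the $a$-cluster of the one labelled $k$; and $\mathcal M,f\vDash\mathcal S$ iff some formula of some component, with label $l$ say, is true at $f(l)$. *Multiformulas* are $\mho::=l{:}\phi\mid(\mho\otimes \mho)\mid(\mho\oplus \mho)$ with $l$ a label; $\mathcal M,f\vDash l{:}\phi$ iff $\mathcal M,f(l)\vDash\phi$, with $\otimes$ read as conjunction and $\oplus$ as disjunction. $\mathrm{Var}^\pm(\mho)$ and $\mathrm{Ag}(\mho)$ are computed after forgetting labels. A *SALIP interpolant* of a labelled split cross-sequent $\mathcal S$ is a multiformula $\mho$ such that: 0. all labels of $\mho$ are labels of $\mathcal S$; 1. $\mathcal M,f\nvDash\mho$ implies $\mathcal M,f\vDash L(\mathcal S)$, for all models $\mathcal M$ and interpretations $f$ of $\mathcal S$ into $\mathcal M$; 2.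 $\mathcal M,f\vDash\mho$ implies $\mathcal M,f\vDash R(\mathcal S)$, for all such $\mathcal M$ and $f$; 3. $\mathrm{Var}^+(\mho)\subseteq\mathrm{Var}^-(L(\mathcal S))\cap\mathrm{Var}^+(R(\mathcal S))$ and $\mathrm{Var}^-(\mho)\subseteq\mathrm{Var}^+(L(\mathcal S))\cap\mathrm{Var}^-(R(\mathcal S))$; 4. $\mathrm{Ag}(\mho)\subseteq\mathrm{Ag}(L(\mathcal S))\cap\mathrm{Ag}(R(\mathcal S))$. **Theorem (SALIP for $\sharp\mathsf{S5}_n$).** If a cross-sequent $\mathcal S$ is derivable in $\sharp\mathsf{S5}_n$ and $d(\mathcal S)=0$, then every split of $\mathcal S$ has a SALIP interpolant. -/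

import Mathlib

universe u v w x

namespace SharpS5

/-! ## Formulas in negation normal form -/

/-- Formulas over atoms `P` and agents `A`, in negation normal form. -/
inductive Fml (P : Type u) (A : Type v) : Type (max u v)
  | bot : Fml P A
  | top : Fml P A
  | pos (p : P) : Fml P A
  | neg (p : P) : Fml P A
  | and (φ ψ : Fml P A) : Fml P A
  | or (φ ψ : Fml P A) : Fml P A
  | box (a : A) (φ : Fml P A) : Fml P A
  | dia (a : A) (φ : Fml P A) : Fml P A
  deriving DecidableEq

/-- Atoms with a positive occurrence. -/
def Fml.varPos {P : Type u} {A : Type v} : Fml P A → Set P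
  | .bot => ∅
  | .top => ∅
  | .pos p => {p}
  | .neg _ => ∅
  | .and φ ψ => φ.varPos ∪ ψ.varPos
  | .or φ ψ => φ.varPos ∪ ψ.varPos
  | .box _ φ => φ.varPos
  | .dia _ φ => φ.varPos

/-- Atoms with a negative occurrence. -/
def Fml.varNeg {P : Type u} {A : Type v} : Fml P A → Set P
  | .bot => ∅
  | .top => ∅
  | .pos _ => ∅
  | .neg p => {p}
  | .and φ ψ => φ.varNeg ∪ ψ.varNeg
  | .or φ ψ => φ.varNeg ∪ ψ.varNeg
  | .box _ φ => φ.varNeg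
  | .dia _ φ => φ.varNeg

/-- Agents occurring in a formula. -/
def Fml.ag {P : Type u} {A : Type v} : Fml P A → Set A
  | .bot => ∅
  | .top => ∅
  | .pos _ => ∅
  | .neg _ => ∅
  | .and φ ψ => φ.ag ∪ ψ.ag
  | .or φ ψ => φ.ag ∪ ψ.ag
  | .box a φ => {a} ∪ φ.ag
  | .dia a φ => {a} ∪ φ.ag

/-! ## Epistemic Kripke models -/

structure Model (P : Type u) (A : Type v) : Type (max u v (w + 1)) where
  World : Type w
  nonempty : Nonempty World
  R : A → World → World → Prop
  equiv : ∀ a, Equivalence (R a)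
  V : P → Set World

/-- `M.Sat w φ`: the formula `φ` is true at the world `w` of `M`. -/
def Model.Sat {P : Type u} {A : Type v} (M : Model.{u, v, w} P A) : M.World → Fml P A → Prop
  | _, .bot => False
  | _, .top => True
  | s, .pos p => s ∈ M.V p
  | s, .neg p => s ∉ M.V p
  | s, .and φ ψ => M.Sat s φ ∧ M.Sat s ψ
  | s, .or φ ψ => M.Sat s φ ∨ M.Sat s ψ
  | s, .box a φ => ∀ t, M.R a s t → M.Sat t φ
  | s, .dia a φ => ∃ t, M.R a s t ∧ M.Sat t φ

/-! ## Cross-sequents -/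

/-- Trees of hypersequents with components from `C`.
`node c br` is the cross-sequent with root component `c` whose `a`-bracket contains the
hypersequent `br a`, for each agent `a`; `br a = []` means that the root has no `a`-bracket.
So a component has at most one `a`-bracket for each agent `a` (the first consolidation condition)
and brackets are never empty. A hypersequent is a multiset; it is listed here in some order, and
no rule below depends on that order. -/
inductive CTree (A : Type v) (C : Type x) : Type (max v x)
  | node (c : C) (br : A → List (CTree A C)) : CTree A C

namespace CTree

variable {A : Type v} {C : Type x}

/-- The root component. -/
def root : CTree A C → C
  | node c _ => c

/-- The hypersequent in the `a`-bracket of the root (`[]` if there is no such bracket). -/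
def bracket : CTree A C → A → List (CTree A C)
  | node _ br => br

/-- A cross-sequent that consists of a single component. -/
def leaf (c : C) : CTree A C := node c (fun _ => [])

mutual
/-- The depth of a cross-sequent. -/
def depth [Fintype A] : CTree A C → ℕ
  | node _ br => Finset.univ.sup (fun a => bracketDepth (br a))
/-- The contribution of one bracket: `0` if absent, otherwise the depth of its content plus `1`. -/
def bracketDepth [Fintype A] : List (CTree A C) → ℕ
  | [] => 0
  | T :: H => max (depth T + 1) (bracketDepth H)
end

mutual
/-- Apply `f` to every component. -/
def map {D : Type*} (f : C → D) : CTree A C → CTree A D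
  | node c br => node (f c) (fun a => mapList f (br a))
/-- Apply `f` to every component of every cross-sequent of a hypersequent. -/
def mapList {D : Type*} (f : C → D) : List (CTree A C) → List (CTree A D)
  | [] => []
  | T :: H => map f T :: mapList f H
end

/-- `IsSub T S`: the cross-sequent `T` is rooted at a component of `S`. -/
inductive IsSub : CTree A C → CTree A C → Prop
  | refl (S : CTree A C) : IsSub S S
  | step {S T : CTree A C} (c : C) (br : A → List (CTree A C)) (a : A) (hT : T ∈ br a)
      (h : IsSub S T) : IsSub S (node c br)

/-- The components of a cross-sequent. -/
def components (S : CTree A C) : Set C := {c | ∃ T, IsSub T S ∧ T.root = c}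

/-- The second consolidation condition: no component within an `a`-bracket has an `a`-bracket. -/
inductive Proper : CTree A C → Prop
  | mk (c : C) (br : A → List (CTree A C))
      (hroot : ∀ a, ∀ T ∈ br a, T.bracket a = [])
      (hrec : ∀ a, ∀ T ∈ br a, Proper T) : Proper (node c br)

/-- Contexts: cross-sequents with one subtree replaced by a hole. -/
inductive Ctx (A : Type v) (C : Type x) : Type (max v x)
  | hole : Ctx A C
  /-- The hole is within the cross-sequent of the `a`-bracket between `H₁` and `H₂`;
  `br` gives the brackets of the other agents. -/
  | inside (c : C) (br : A → List (CTree A C)) (a : A) (H₁ : List (CTree A C)) (K : Ctx A C)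
      (H₂ : List (CTree A C)) : Ctx A C

/-- Insert a cross-sequent in place of the hole. -/
def Ctx.fill [DecidableEq A] : Ctx A C → CTree A C → CTree A C
  | .hole, T => T
  | .inside c br a H₁ K H₂, T => node c (Function.update br a (H₁ ++ K.fill T :: H₂))

end CTree

/-- A (one-sided) sequent is a finite set of formulas. -/
abbrev Sequent (P : Type u) (A : Type v) : Type (max u v) := Finset (Fml P A)

abbrev CrossSequent (P : Type u) (A : Type v) : Type (max u v) := CTree A (Sequent P A)

/-! ## The calculus -/

section Calculus

variable {P : Type u} {A : Type v} [DecidableEq P] [DecidableEq A]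

/-- Add a formula to the root component. -/
def CrossSequent.add (φ : Fml P A) : CrossSequent P A → CrossSequent P A
  | .node Δ br => .node (insert φ Δ) br

open CTree in
/-- The rules, without the surrounding context: `Rule T ps` means that `T` can be inferred from
the premises `ps`. -/
inductive Rule : CrossSequent P A → List (CrossSequent P A) → Prop
  | id (Δ : Sequent P A) (br : A → List (CrossSequent P A)) (p : P)
      (hp : Fml.pos p ∈ Δ) (hn : Fml.neg p ∈ Δ) : Rule (node Δ br) []
  | top (Δ : Sequent P A) (br : A → List (CrossSequent P A))
      (h : Fml.top ∈ Δ) : Rule (node Δ br) []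
  | or (Δ : Sequent P A) (br : A → List (CrossSequent P A)) (φ ψ : Fml P A)
      (h : Fml.or φ ψ ∈ Δ) : Rule (node Δ br) [node (insert φ (insert ψ Δ)) br]
  | and (Δ : Sequent P A) (br : A → List (CrossSequent P A)) (φ ψ : Fml P A)
      (h : Fml.and φ ψ ∈ Δ) :
      Rule (node Δ br) [node (insert φ Δ) br, node (insert ψ Δ) br]
  /-- `□ₐ φ` in a component within an `a`-bracket creates another `a`-sibling. -/
  | boxIn (Δ : Sequent P A) (br : A → List (CrossSequent P A)) (a : A) (φ : Fml P A)
      (T : CrossSequent P A) (hT : T ∈ br a) (h : Fml.box a φ ∈ T.root) :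
      Rule (node Δ br) [node Δ (Function.update br a (leaf {φ} :: br a))]
  /-- `□ₐ φ` in a component with an `a`-bracket creates another `a`-child. -/
  | boxUp (Δ : Sequent P A) (br : A → List (CrossSequent P A)) (a : A) (φ : Fml P A)
      (h : Fml.box a φ ∈ Δ) (hbr : br a ≠ []) :
      Rule (node Δ br) [node Δ (Function.update br a (leaf {φ} :: br a))]
  /-- `□ₐ φ` in a component without an `a`-bracket creates the first `a`-child. (That the component
  is not itself within an `a`-bracket is due to the premise being proper.) -/
  | boxNew (Δ : Sequent P A) (br : A → List (CrossSequent P A)) (a : A) (φ : Fml P A)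
      (h : Fml.box a φ ∈ Δ) (hbr : br a = []) :
      Rule (node Δ br) [node Δ (Function.update br a [leaf {φ}])]
  /-- `◇ₐ φ` adds `φ` to an `a`-sibling. -/
  | diaIn (Δ : Sequent P A) (br : A → List (CrossSequent P A)) (a : A) (φ : Fml P A)
      (H₁ H₂ : List (CrossSequent P A)) (T U : CrossSequent P A)
      (hbr : br a = H₁ ++ U :: H₂) (hT : T ∈ H₁ ++ H₂) (h : Fml.dia a φ ∈ T.root) :
      Rule (node Δ br) [node Δ (Function.update br a (H₁ ++ CrossSequent.add φ U :: H₂))]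
  /-- `◇ₐ φ` adds `φ` to an `a`-child. -/
  | diaUp (Δ : Sequent P A) (br : A → List (CrossSequent P A)) (a : A) (φ : Fml P A)
      (H₁ H₂ : List (CrossSequent P A)) (U : CrossSequent P A)
      (hbr : br a = H₁ ++ U :: H₂) (h : Fml.dia a φ ∈ Δ) :
      Rule (node Δ br) [node Δ (Function.update br a (H₁ ++ CrossSequent.add φ U :: H₂))]
  /-- `◇ₐ φ` adds `φ` to its own component. -/
  | diaT (Δ : Sequent P A) (br : A → List (CrossSequent P A)) (a : A) (φ : Fml P A)
      (h : Fml.dia a φ ∈ Δ) : Rule (node Δ br) [node (insert φ Δ) br]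
  /-- `◇ₐ φ` adds `φ` to the `a`-parent. -/
  | diaDown (Δ : Sequent P A) (br : A → List (CrossSequent P A)) (a : A) (φ : Fml P A)
      (T : CrossSequent P A) (hT : T ∈ br a) (h : Fml.dia a φ ∈ T.root) :
      Rule (node Δ br) [node (insert φ Δ) br]

/-- Derivability: rules are applied in arbitrary contexts, and every cross-sequent in a derivation
is proper. -/
inductive Derivable : CrossSequent P A → Prop
  | step (K : CTree.Ctx A (Sequent P A)) (T : CrossSequent P A) (ps : List (CrossSequent P A))
      (hrule : Rule T ps) (hproper : (K.fill T).Proper)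
      (hprem : ∀ T' ∈ ps, Derivable (K.fill T')) : Derivable (K.fill T)

end Calculus

/-! ## Atoms and agents of (labelled) cross-sequents -/

/-- A cross-sequent (with components from `C`) whose components carry natural numbers as labels. -/
abbrev Labelled (A : Type v) (C : Type x) : Type (max v x) := CTree A (ℕ × C)

namespace Labelled

variable {P : Type u} {A : Type v} {C : Type x}

/-- The set of labels of the components. -/
def labels (S : Labelled A C) : Set ℕ := {l | ∃ c ∈ S.components, c.1 = l}

/-- Distinct components have distinct labels. -/
inductive Unique : Labelled A C → Prop
  | mk (c : ℕ × C) (br : A → List (Labelled A C))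
      (hroot : ∀ a, ∀ T ∈ br a, c.1 ∉ labels T)
      (hsib : ∀ a, (br a).Pairwise (fun T U => Disjoint (labels T) (labels U)))
      (hbr : ∀ a b, a ≠ b → ∀ T ∈ br a, ∀ U ∈ br b, Disjoint (labels T) (labels U))
      (hrec : ∀ a, ∀ T ∈ br a, Unique T) : Unique (CTree.node c br)

/-- The component labelled `l` is an `a`-child of the component labelled `k`. -/
def Child (S : Labelled A C) (a : A) (k l : ℕ) : Prop :=
  ∃ T, CTree.IsSub T S ∧ T.root.1 = k ∧ ∃ U ∈ T.bracket a, U.root.1 = l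

/-- The component labelled `l` belongs to the `a`-cluster of the component labelled `k`:
it is the same component, its `a`-parent, an `a`-sibling or an `a`-child. -/
def InCluster (S : Labelled A C) (a : A) (k l : ℕ) : Prop :=
  (k ∈ S.labels ∧ l = k) ∨ S.Child a l k ∨ (∃ m, S.Child a m k ∧ S.Child a m l) ∨ S.Child a k l

/-- `f` is an interpretation of `S` into `M`. (Only the values of `f` at labels of `S` matter;
a partial map that is defined on them is extended arbitrarily.) -/
def IsInterpretation (S : Labelled A C) (M : Model.{u, v, w} P A) (f : ℕ → M.World) : Prop :=
  ∀ a k l, S.InCluster a k l → M.R a (f k) (f l)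

/-- Truth of a labelled cross-sequent under an interpretation. -/
def Sat (M : Model.{u, v, w} P A) (f : ℕ → M.World) (S : Labelled A (Sequent P A)) : Prop :=
  ∃ c ∈ S.components, ∃ φ ∈ c.2, M.Sat (f c.1) φ

def varPos (S : Labelled A (Sequent P A)) : Set P := {p | ∃ c ∈ S.components, ∃ φ ∈ c.2, p ∈ φ.varPos}

def varNeg (S : Labelled A (Sequent P A)) : Set P := {p | ∃ c ∈ S.components, ∃ φ ∈ c.2, p ∈ φ.varNeg}

def ag (S : Labelled A (Sequent P A)) : Set A := {a | ∃ c ∈ S.components, ∃ φ ∈ c.2, a ∈ φ.ag}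

end Labelled

/-! ## Splits -/

/-- A split sequent `left ; right`. -/
structure SplitSequent (P : Type u) (A : Type v) : Type (max u v) where
  left : Sequent P A
  right : Sequent P A

/-- A split cross-sequent with labelled components. -/
abbrev Split (P : Type u) (A : Type v) : Type (max u v) := Labelled A (SplitSequent P A)

namespace Split

variable {P : Type u} {A : Type v}

/-- The left side: all formulas to the right of a semicolon are removed. -/
def L (X : Split P A) : Labelled A (Sequent P A) := CTree.map (fun c => (c.1, c.2.left)) X

/-- The right side: all formulas to the left of a semicolon are removed. -/
def R (X : Split P A) : Labelled A (Sequent P A) := CTree.map (fun c => (c.1, c.2.right)) X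

/-- The cross-sequent that `X` is a split of: semicolons and labels are forgotten. -/
def merge [DecidableEq P] [DecidableEq A] (X : Split P A) : CrossSequent P A :=
  CTree.map (fun c => c.2.left ∪ c.2.right) X

/-- `X` is a split of `S`, with its components labelled by distinct numbers and its root
labelled by `0`. The two sides of a component may overlap. -/
def IsSplitOf [DecidableEq P] [DecidableEq A] (X : Split P A) (S : CrossSequent P A) : Prop :=
  X.merge = S ∧ Labelled.Unique X ∧ X.root.1 = 0

end Split

/-! ## Multiformulas and interpolants -/

inductive Multiformula (P : Type u) (A : Type v) : Type (max u v)
  | lab (l : ℕ) (φ : Fml P A) : Multiformula P A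
  | conj (m n : Multiformula P A) : Multiformula P A
  | disj (m n : Multiformula P A) : Multiformula P A

namespace Multiformula

variable {P : Type u} {A : Type v}

def labels : Multiformula P A → Set ℕ
  | lab l _ => {l}
  | conj m n => m.labels ∪ n.labels
  | disj m n => m.labels ∪ n.labels

/-- The label-forgetting projection. -/
def forget : Multiformula P A → Fml P A
  | lab _ φ => φ
  | conj m n => .and m.forget n.forget
  | disj m n => .or m.forget n.forget

def Sat (M : Model.{u, v, w} P A) (f : ℕ → M.World) : Multiformula P A → Prop
  | lab l φ => M.Sat (f l) φ
  | conj m n => m.Sat M f ∧ n.Sat M f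
  | disj m n => m.Sat M f ∨ n.Sat M f

/-- SLIP interpolants of a split cross-sequent (models range over `Type w`). -/
structure IsSLIP (m : Multiformula P A) (X : Split P A) : Prop where
  labels_subset : m.labels ⊆ Labelled.labels X
  left_side : ∀ (M : Model.{u, v, w} P A) (f : ℕ → M.World), Labelled.IsInterpretation X M f →
    ¬ m.Sat M f → Labelled.Sat M f X.L
  right_side : ∀ (M : Model.{u, v, w} P A) (f : ℕ → M.World), Labelled.IsInterpretation X M f →
    m.Sat M f → Labelled.Sat M f X.R
  varPos_subset : m.forget.varPos ⊆ X.L.varNeg ∩ X.R.varPos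
  varNeg_subset : m.forget.varNeg ⊆ X.L.varPos ∩ X.R.varNeg

/-- SALIP interpolants of a split cross-sequent (models range over `Type w`). -/
structure IsSALIP (m : Multiformula P A) (X : Split P A) : Prop
    extends IsSLIP.{u, v, w} m X where
  ag_subset : m.forget.ag ⊆ X.L.ag ∩ X.R.ag

end Multiformula

end SharpS5

namespace SharpS5

-- Maehara's method: an interpolant is built by induction on the derivation, for cross-sequents of
-- any depth and all their splits at once. A split becomes a `PathSequent`, in which each formula
-- has a side and a path, i.e. the position of its component. `Realises` only asks that every
-- formula of the cross-sequent occur at its path on some side; surplus formulas are harmless, so a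
-- premise is treated by adding the new formula on the side of the principal one.
--
-- Conjunction joins the interpolants of its premises; disjunction and diamond keep that of their
-- premise. A box for `a` opens a new path `n` above some `k`, and the label `n` must disappear. In
-- disjunctive normal form the interpolant is a disjunction of pairs `φ` at `n` and a rest without
-- `n`; on the left, `φ` at `n` is replaced by `◇ₐ φ` at `k` (`PathFormula.exists_elim`), and on the
-- right the same is done to the negation, which yields boxes.
--
-- Agents are controlled by the invariant `WF`: a formula lies at a path all of whose agents belong
-- to the vocabulary of its side. Modal rules preserve this, because they move within an `a`-cluster
-- for an agent `a` of the principal formula. Hence clashing literals on opposite sides lie at a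
-- path of common agents, and interpolants need only such paths as labels (`PathSequent.shared`). If
-- the path opened by a box has an agent that is not common, its label does not occur in the
-- interpolant, which can be kept as it is (`PathSequent.hasInterpolant_of_box`). So modalities of
-- common agents only are ever introduced.

variable {P : Type u} {A : Type v}

/-! ## Vocabularies and negation -/

/-- A vocabulary: atoms allowed positively, atoms allowed negatively, and agents. -/
structure Vocab (P : Type u) (A : Type v) where
  pos : Set P
  neg : Set P
  ag : Set A

namespace Vocab

/-- The vocabulary with the polarities of the atoms exchanged. -/
def dual (C : Vocab P A) : Vocab P A := ⟨C.neg, C.pos, C.ag⟩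

/-- The common vocabulary of the left side `V false` and the right side `V true`. -/
def common (V : Bool → Vocab P A) : Vocab P A :=
  ⟨(V false).neg ∩ (V true).pos, (V false).pos ∩ (V true).neg, (V false).ag ∩ (V true).ag⟩

end Vocab

/-- `φ` is a formula in the vocabulary `C`. -/
def Fml.Within (φ : Fml P A) (C : Vocab P A) : Prop :=
  φ.varPos ⊆ C.pos ∧ φ.varNeg ⊆ C.neg ∧ φ.ag ⊆ C.ag

theorem Fml.within_and {φ ψ : Fml P A} {C : Vocab P A} :
    (Fml.and φ ψ).Within C ↔ φ.Within C ∧ ψ.Within C := by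
  simp only [Fml.Within, Fml.varPos, Fml.varNeg, Fml.ag, Set.union_subset_iff]
  tauto

theorem Fml.within_or {φ ψ : Fml P A} {C : Vocab P A} :
    (Fml.or φ ψ).Within C ↔ φ.Within C ∧ ψ.Within C := Fml.within_and

theorem Fml.within_box {a : A} {φ : Fml P A} {C : Vocab P A} :
    (Fml.box a φ).Within C ↔ a ∈ C.ag ∧ φ.Within C := by
  simp only [Fml.Within, Fml.varPos, Fml.varNeg, Fml.ag, Set.union_subset_iff,
    Set.singleton_subset_iff]
  tauto

theorem Fml.within_dia {a : A} {φ : Fml P A} {C : Vocab P A} :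
    (Fml.dia a φ).Within C ↔ a ∈ C.ag ∧ φ.Within C := Fml.within_box

theorem Fml.within_bot (C : Vocab P A) : (Fml.bot : Fml P A).Within C :=
  ⟨Set.empty_subset _, Set.empty_subset _, Set.empty_subset _⟩

theorem Fml.within_top (C : Vocab P A) : (Fml.top : Fml P A).Within C :=
  ⟨Set.empty_subset _, Set.empty_subset _, Set.empty_subset _⟩

/-- The negation of a formula, in negation normal form. -/
def Fml.not : Fml P A → Fml P A
  | .bot => .top
  | .top => .bot
  | .pos p => .neg p
  | .neg p => .pos p
  | .and φ ψ => .or φ.not ψ.not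
  | .or φ ψ => .and φ.not ψ.not
  | .box a φ => .dia a φ.not
  | .dia a φ => .box a φ.not

theorem Fml.within_not {φ : Fml P A} {C : Vocab P A} (h : φ.Within C) : φ.not.Within C.dual := by
  induction φ with
  | bot => exact Fml.within_top _
  | top => exact Fml.within_bot _
  | pos p => exact ⟨h.2.1, h.1, h.2.2⟩
  | neg p => exact ⟨h.2.1, h.1, h.2.2⟩
  | and φ ψ ih₁ ih₂ =>
    exact Fml.within_or.2 ⟨ih₁ (Fml.within_and.1 h).1, ih₂ (Fml.within_and.1 h).2⟩
  | or φ ψ ih₁ ih₂ =>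
    exact Fml.within_and.2 ⟨ih₁ (Fml.within_or.1 h).1, ih₂ (Fml.within_or.1 h).2⟩
  | box a φ ih => exact Fml.within_dia.2 ⟨(Fml.within_box.1 h).1, ih (Fml.within_box.1 h).2⟩
  | dia a φ ih => exact Fml.within_box.2 ⟨(Fml.within_dia.1 h).1, ih (Fml.within_dia.1 h).2⟩

theorem Model.sat_not (M : Model.{u, v, w} P A) (s : M.World) (φ : Fml P A) :
    M.Sat s φ.not ↔ ¬ M.Sat s φ := by
  induction φ generalizing s with
  | bot => simp [Fml.not, Model.Sat]
  | top => simp [Fml.not, Model.Sat]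
  | pos p => simp [Fml.not, Model.Sat]
  | neg p => simp [Fml.not, Model.Sat]
  | and φ ψ ih₁ ih₂ => simp only [Fml.not, Model.Sat, ih₁, ih₂]; tauto
  | or φ ψ ih₁ ih₂ => simp only [Fml.not, Model.Sat, ih₁, ih₂]; tauto
  | box a φ ih => simp [Fml.not, Model.Sat, ih]
  | dia a φ ih => simp [Fml.not, Model.Sat, ih]

/-! ## Multiformulas labelled by paths -/

/-- The position of a component relative to the root: the agents of the brackets around it,
innermost first, each with an index. -/
abbrev Path (A : Type v) : Type v := List (A × ℕ)

/-- Multiformulas whose labels are paths. -/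
inductive PathFormula (P : Type u) (A : Type v) : Type (max u v)
  | lab (x : Path A) (φ : Fml P A) : PathFormula P A
  | conj (m n : PathFormula P A) : PathFormula P A
  | disj (m n : PathFormula P A) : PathFormula P A

namespace PathFormula

def Sat (M : Model.{u, v, w} P A) (f : Path A → M.World) : PathFormula P A → Prop
  | lab x φ => M.Sat (f x) φ
  | conj m n => m.Sat M f ∧ n.Sat M f
  | disj m n => m.Sat M f ∨ n.Sat M f

/-- All labels lie in `Q` and all formulas are in the vocabulary `C`. -/
def Over (Q : Set (Path A)) (C : Vocab P A) : PathFormula P A → Prop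
  | lab x φ => x ∈ Q ∧ φ.Within C
  | conj m n => m.Over Q C ∧ n.Over Q C
  | disj m n => m.Over Q C ∧ n.Over Q C

def forget : PathFormula P A → Fml P A
  | lab _ φ => φ
  | conj m n => .and m.forget n.forget
  | disj m n => .or m.forget n.forget

def not : PathFormula P A → PathFormula P A
  | lab x φ => lab x φ.not
  | conj m n => disj m.not n.not
  | disj m n => conj m.not n.not

theorem Over.mono {Q Q' : Set (Path A)} {C : Vocab P A} (hQ : Q ⊆ Q') {m : PathFormula P A}
    (h : m.Over Q C) : m.Over Q' C := by
  induction m with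
  | lab x φ => exact ⟨hQ h.1, h.2⟩
  | conj m n ihm ihn => exact ⟨ihm h.1, ihn h.2⟩
  | disj m n ihm ihn => exact ⟨ihm h.1, ihn h.2⟩

theorem Over.not {Q : Set (Path A)} {C : Vocab P A} {m : PathFormula P A}
    (h : m.Over Q C) : m.not.Over Q C.dual := by
  induction m with
  | lab x φ => exact ⟨h.1, Fml.within_not h.2⟩
  | conj m n ihm ihn => exact ⟨ihm h.1, ihn h.2⟩
  | disj m n ihm ihn => exact ⟨ihm h.1, ihn h.2⟩

theorem Over.within_forget {Q : Set (Path A)} {C : Vocab P A} {m : PathFormula P A}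
    (h : m.Over Q C) : m.forget.Within C := by
  induction m with
  | lab x φ => exact h.2
  | conj m n ihm ihn => exact Fml.within_and.2 ⟨ihm h.1, ihn h.2⟩
  | disj m n ihm ihn => exact Fml.within_or.2 ⟨ihm h.1, ihn h.2⟩

theorem sat_not (M : Model.{u, v, w} P A) (f : Path A → M.World) (m : PathFormula P A) :
    m.not.Sat M f ↔ ¬ m.Sat M f := by
  induction m with
  | lab x φ => exact M.sat_not _ φ
  | conj m n ihm ihn => simp only [PathFormula.not, Sat, ihm, ihn]; tauto
  | disj m n ihm ihn => simp only [PathFormula.not, Sat, ihm, ihn]; tauto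

theorem sat_congr {Q : Set (Path A)} {C : Vocab P A} (M : Model.{u, v, w} P A)
    {f g : Path A → M.World} (hfg : ∀ x ∈ Q, f x = g x) {m : PathFormula P A} (h : m.Over Q C) :
    m.Sat M f ↔ m.Sat M g := by
  induction m with
  | lab x φ => simp only [Sat, hfg x h.1]
  | conj m n ihm ihn => simp only [Sat, ihm h.1, ihn h.2]
  | disj m n ihm ihn => simp only [Sat, ihm h.1, ihn h.2]

/-- When all labels are `[]`, a multiformula amounts to a formula. -/
theorem sat_forget {C : Vocab P A} (M : Model.{u, v, w} P A)
    (f : Path A → M.World) {m : PathFormula P A} (h : m.Over {[]} C) :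
    M.Sat (f []) m.forget ↔ m.Sat M f := by
  induction m with
  | lab x φ => simp only [forget, Sat, Set.mem_singleton_iff.1 h.1]
  | conj m n ihm ihn => simp only [forget, Sat, Model.Sat, ihm h.1, ihn h.2]
  | disj m n ihm ihn => simp only [forget, Sat, Model.Sat, ihm h.1, ihn h.2]

/-- Disjunctive normal form with respect to a single label `n`. -/
theorem exists_dnf {Q : Set (Path A)} {C : Vocab P A} (hQ : [] ∈ Q) (n : Path A)
    {m : PathFormula P A} (h : m.Over (insert n Q) C) :
    ∃ D : List (Fml P A × PathFormula P A), (∀ d ∈ D, d.1.Within C ∧ d.2.Over Q C) ∧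
      ∀ (M : Model.{u, v, w} P A) (f : Path A → M.World),
        m.Sat M f ↔ ∃ d ∈ D, M.Sat (f n) d.1 ∧ d.2.Sat M f := by
  induction m with
  | lab x φ =>
    by_cases hx : x ∈ Q
    · refine ⟨[(.top, lab x φ)], ?_, ?_⟩
      · simpa using ⟨Fml.within_top C, hx, h.2⟩
      · simp [Sat, Model.Sat]
    · obtain rfl : x = n := h.1.resolve_right hx
      -- The second entry is a vacuous conjunct; it needs some label in `Q`, and `[]` serves.
      refine ⟨[(φ, lab [] .top)], ?_, ?_⟩
      · simpa using ⟨h.2, hQ, Fml.within_top C⟩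
      · simp [Sat, Model.Sat]
  | conj m₁ m₂ ih₁ ih₂ =>
    obtain ⟨D₁, hD₁, hs₁⟩ := ih₁ h.1
    obtain ⟨D₂, hD₂, hs₂⟩ := ih₂ h.2
    refine ⟨(D₁ ×ˢ D₂).map (fun d => (.and d.1.1 d.2.1, conj d.1.2 d.2.2)), ?_, ?_⟩
    · intro d hd
      obtain ⟨⟨d₁, d₂⟩, hd', rfl⟩ := List.mem_map.1 hd
      obtain ⟨h₁, h₂⟩ := List.mem_product.1 hd'
      exact ⟨Fml.within_and.2 ⟨(hD₁ _ h₁).1, (hD₂ _ h₂).1⟩, (hD₁ _ h₁).2, (hD₂ _ h₂).2⟩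
    · intro M f
      simp only [Sat, hs₁, hs₂]
      constructor
      · rintro ⟨⟨d₁, h₁, h₁', h₁''⟩, d₂, h₂, h₂', h₂''⟩
        exact ⟨_, List.mem_map.2 ⟨(d₁, d₂), List.mem_product.2 ⟨h₁, h₂⟩, rfl⟩,
          ⟨h₁', h₂'⟩, h₁'', h₂''⟩
      · rintro ⟨d, hd, h', h''⟩
        obtain ⟨⟨d₁, d₂⟩, hd', rfl⟩ := List.mem_map.1 hd
        obtain ⟨h₁, h₂⟩ := List.mem_product.1 hd'
        exact ⟨⟨d₁, h₁, h'.1, h''.1⟩, d₂, h₂, h'.2, h''.2⟩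
  | disj m₁ m₂ ih₁ ih₂ =>
    obtain ⟨D₁, hD₁, hs₁⟩ := ih₁ h.1
    obtain ⟨D₂, hD₂, hs₂⟩ := ih₂ h.2
    refine ⟨D₁ ++ D₂, ?_, ?_⟩
    · intro d hd
      exact (List.mem_append.1 hd).elim (hD₁ d) (hD₂ d)
    · intro M f
      simp only [Sat, hs₁, hs₂, List.mem_append, or_and_right, exists_or]

/-- The empty disjunction is `⊥` at the root path, whence the assumption on `[]`. -/
theorem exists_bigDisj {Q : Set (Path A)} {C : Vocab P A} (hQ : [] ∈ Q)
    (D : List (PathFormula P A)) (hD : ∀ d ∈ D, d.Over Q C) :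
    ∃ m : PathFormula P A, m.Over Q C ∧
      ∀ (M : Model.{u, v, w} P A) (f : Path A → M.World), m.Sat M f ↔ ∃ d ∈ D, d.Sat M f := by
  induction D with
  | nil => exact ⟨lab [] .bot, ⟨hQ, Fml.within_bot C⟩, by simp [Sat, Model.Sat]⟩
  | cons d D ih =>
    obtain ⟨m, hm, hs⟩ := ih (fun e he => hD e (List.mem_cons_of_mem _ he))
    exact ⟨disj d m, ⟨hD d List.mem_cons_self, hm⟩, by simp [Sat, hs]⟩

end PathFormula

/-- Send the path `n` and everything above it to `v`. -/
def graft [DecidableEq A] {W : Type w} (f : Path A → W) (n : Path A) (v : W) (x : Path A) : W :=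
  if n <:+ x then v else f x

open PathFormula in
/-- Elimination of a label in favour of a diamond at its parent. -/
theorem PathFormula.exists_elim [DecidableEq A] {Q : Set (Path A)} {C : Vocab P A} (hQ : [] ∈ Q)
    {a : A} {i : ℕ} {k : Path A} (hn : ∀ x ∈ Q, ¬ ((a, i) :: k) <:+ x) (hk : k ∈ Q)
    (ha : a ∈ C.ag) {m : PathFormula P A} (h : m.Over (insert ((a, i) :: k) Q) C) :
    ∃ m' : PathFormula P A, m'.Over Q C ∧
      ∀ (M : Model.{u, v, w} P A) (f : Path A → M.World),
        m'.Sat M f ↔ ∃ v, M.R a (f k) v ∧ m.Sat M (graft f ((a, i) :: k) v) := by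
  obtain ⟨D, hD, hs⟩ := exists_dnf.{u, v, w} hQ ((a, i) :: k) h
  -- The quantifier over `v` commutes with the disjunction and passes by `d.2`, which does not
  -- depend on `v`; on `d.1` it becomes the diamond.
  obtain ⟨m', hm', hs'⟩ := exists_bigDisj.{u, v, w} (C := C) hQ
    (D.map fun d => conj (lab k (.dia a d.1)) d.2) (by
      intro e he
      obtain ⟨d, hd, rfl⟩ := List.mem_map.1 he
      exact ⟨⟨hk, Fml.within_dia.2 ⟨ha, (hD d hd).1⟩⟩, (hD d hd).2⟩)
  refine ⟨m', hm', fun M f => ?_⟩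
  have key : ∀ v, ∀ d ∈ D, d.2.Sat M (graft f ((a, i) :: k) v) ↔ d.2.Sat M f := fun v d hd =>
    sat_congr M (fun x hx => if_neg (hn x hx)) (hD d hd).2
  rw [hs']
  constructor
  · rintro ⟨e, he, hsat⟩
    obtain ⟨d, hd, rfl⟩ := List.mem_map.1 he
    obtain ⟨⟨v, hv, hφ⟩, h₂⟩ := hsat
    refine ⟨v, hv, (hs M _).2 ⟨d, hd, ?_, (key v d hd).2 h₂⟩⟩
    simpa [graft] using hφ
  · rintro ⟨v, hv, hsat⟩
    obtain ⟨d, hd, h₁, h₂⟩ := (hs M _).1 hsat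
    refine ⟨_, List.mem_map.2 ⟨d, hd, rfl⟩, ⟨v, hv, ?_⟩, (key v d hd).1 h₂⟩
    simpa [graft] using h₁

/-! ## Split sequents of formulas at paths -/

/-- A split cross-sequent in labelled form: the paths in use, and the formulas at these paths,
on the left side (`false`) or on the right side (`true`). -/
structure PathSequent (P : Type u) (A : Type v) where
  used : Set (Path A)
  fml : Set (Bool × Path A × Fml P A)

/-- Interpretations of paths: each step follows the accessibility relation of its agent. -/
def IsPathInterpretation (M : Model.{u, v, w} P A) (f : Path A → M.World) : Prop :=
  ∀ x a i, M.R a (f x) (f ((a, i) :: x))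

/-- Everything at or above the grafted path goes to one world, so steps there hold by reflexivity.
The only step that crosses the boundary is the one from `k`, and this is `hv`. -/
theorem IsPathInterpretation.graft [DecidableEq A] {M : Model.{u, v, w} P A}
    {f : Path A → M.World} (hf : IsPathInterpretation M f) {a : A} {i : ℕ} {k : Path A}
    {v : M.World} (hv : M.R a (f k) v) :
    IsPathInterpretation M (graft f ((a, i) :: k) v) := by
  intro x b j
  by_cases h₁ : ((a, i) :: k) <:+ x
  · have h₂ : ((a, i) :: k) <:+ (b, j) :: x := h₁.trans (List.suffix_cons _ _)
    simp only [SharpS5.graft, h₁, h₂, if_true]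
    exact (M.equiv b).refl v
  · by_cases h₂ : ((a, i) :: k) <:+ (b, j) :: x
    · simp only [SharpS5.graft, h₁, h₂, if_true, if_false]
      rcases List.suffix_cons_iff.1 h₂ with h | h
      · simp only [List.cons.injEq, Prod.mk.injEq] at h
        obtain ⟨⟨rfl, rfl⟩, rfl⟩ := h
        exact hv
      · exact absurd h h₁
    · simp only [SharpS5.graft, h₁, h₂, if_false]
      exact hf x b j

namespace PathSequent

/-- Some formula of the side `b` is true. -/
def Holds (S : PathSequent P A) (b : Bool) (M : Model.{u, v, w} P A) (f : Path A → M.World) :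
    Prop :=
  ∃ k φ, (b, k, φ) ∈ S.fml ∧ M.Sat (f k) φ

instance : LE (PathSequent P A) := ⟨fun S S' => S.used ⊆ S'.used ∧ S.fml ⊆ S'.fml⟩

/-- The formulas of each side, and the paths to them, are in the vocabulary of that side. -/
structure WF (V : Bool → Vocab P A) (S : PathSequent P A) : Prop where
  nil_mem : [] ∈ S.used
  bounded : ∃ N : ℕ, ∀ x ∈ S.used, ∀ y ∈ x, y.2 < N
  mem_used : ∀ b k φ, (b, k, φ) ∈ S.fml → k ∈ S.used
  ag_path : ∀ b k φ, (b, k, φ) ∈ S.fml → ∀ y ∈ k, y.1 ∈ (V b).ag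
  within : ∀ b k φ, (b, k, φ) ∈ S.fml → φ.Within (V b)

/-- The paths that may occur in an interpolant. -/
def shared (V : Bool → Vocab P A) (S : PathSequent P A) : Set (Path A) :=
  {x | x ∈ S.used ∧ ∀ y ∈ x, y.1 ∈ (Vocab.common V).ag}

/-- The vocabularies are parameters, not computed from `S`, so that they stay fixed along a
derivation. -/
structure IsInterpolant (V : Bool → Vocab P A) (S : PathSequent P A) (m : PathFormula P A) :
    Prop where
  labels_within : m.Over (S.shared V) (Vocab.common V)
  left : ∀ (M : Model.{u, v, w} P A) (f : Path A → M.World), IsPathInterpretation M f →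
    ¬ m.Sat M f → S.Holds false M f
  right : ∀ (M : Model.{u, v, w} P A) (f : Path A → M.World), IsPathInterpretation M f →
    m.Sat M f → S.Holds true M f

def HasInterpolant (V : Bool → Vocab P A) (S : PathSequent P A) : Prop :=
  ∃ m, IsInterpolant.{u, v, w} V S m

/-- Add the formula `φ` at the path `k` to the side `b`. -/
def add (S : PathSequent P A) (b : Bool) (k : Path A) (φ : Fml P A) : PathSequent P A :=
  ⟨insert k S.used, insert (b, k, φ) S.fml⟩

theorem le_add (S : PathSequent P A) (b : Bool) (k : Path A) (φ : Fml P A) : S ≤ S.add b k φ :=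
  ⟨Set.subset_insert _ _, Set.subset_insert _ _⟩

theorem le_trans' {S S' S'' : PathSequent P A} (h : S ≤ S') (h' : S' ≤ S'') : S ≤ S'' :=
  ⟨h.1.trans h'.1, h.2.trans h'.2⟩

theorem mem_add (S : PathSequent P A) (b : Bool) (k : Path A) (φ : Fml P A) :
    (b, k, φ) ∈ (S.add b k φ).fml := Set.mem_insert _ _

theorem holds_add {S : PathSequent P A} {b c : Bool} {k : Path A} {φ : Fml P A}
    {M : Model.{u, v, w} P A} {f : Path A → M.World} :
    (S.add b k φ).Holds c M f ↔ (c = b ∧ M.Sat (f k) φ) ∨ S.Holds c M f := by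
  constructor
  · rintro ⟨k', φ', h | h, hs⟩
    · simp only [Prod.mk.injEq] at h
      obtain ⟨rfl, rfl, rfl⟩ := h
      exact .inl ⟨rfl, hs⟩
    · exact .inr ⟨k', φ', h, hs⟩
  · rintro (⟨rfl, hs⟩ | ⟨k', φ', h, hs⟩)
    · exact ⟨k, φ, S.mem_add _ _ _, hs⟩
    · exact ⟨k', φ', .inr h, hs⟩

variable {V : Bool → Vocab P A} {S : PathSequent P A}

theorem WF.add {b : Bool} {k : Path A} {φ : Fml P A} (h : S.WF V) (hk : ∀ y ∈ k, y.1 ∈ (V b).ag)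
    (hφ : φ.Within (V b)) : (S.add b k φ).WF V where
  nil_mem := .inr h.nil_mem
  bounded := by
    obtain ⟨N, hN⟩ := h.bounded
    -- The sum is a crude bound for each index on `k`.
    refine ⟨max N ((k.map Prod.snd).sum + 1), ?_⟩
    rintro x (rfl | hx) y hy
    · have := List.le_sum_of_mem (List.mem_map_of_mem (f := Prod.snd) hy)
      omega
    · have := hN x hx y hy
      omega
  mem_used := by
    rintro c k' φ' (h' | h')
    · simp only [Prod.mk.injEq] at h'
      exact .inl h'.2.1
    · exact .inr (h.mem_used _ _ _ h')
  ag_path := by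
    rintro c k' φ' (h' | h')
    · simp only [Prod.mk.injEq] at h'
      obtain ⟨rfl, rfl, rfl⟩ := h'
      exact hk
    · exact h.ag_path _ _ _ h'
  within := by
    rintro c k' φ' (h' | h')
    · simp only [Prod.mk.injEq] at h'
      obtain ⟨rfl, rfl, rfl⟩ := h'
      exact hφ
    · exact h.within _ _ _ h'

theorem WF.nil_mem_shared (h : S.WF V) : [] ∈ S.shared V := ⟨h.nil_mem, by simp⟩

theorem shared_add {b : Bool} {k : Path A} {φ : Fml P A} (hk : k ∈ S.used) :
    (S.add b k φ).shared V = S.shared V := by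
  simp [shared, add, Set.insert_eq_of_mem hk]

theorem HasInterpolant.of_holds {S' : PathSequent P A}
    (h : HasInterpolant.{u, v, w} V S') (hsh : S'.shared V = S.shared V)
    (hh : ∀ (M : Model.{u, v, w} P A) (f : Path A → M.World) (b : Bool),
      IsPathInterpretation M f → S'.Holds b M f → S.Holds b M f) :
    HasInterpolant.{u, v, w} V S := by
  obtain ⟨m, hm⟩ := h
  exact ⟨m, hsh ▸ hm.labels_within, fun M f hf h => hh M f _ hf (hm.left M f hf h),
    fun M f hf h => hh M f _ hf (hm.right M f hf h)⟩

-- Interpolants for the single rules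

theorem hasInterpolant_of_top (hS : S.WF V) {b : Bool} {k : Path A}
    (h : (b, k, Fml.top) ∈ S.fml) : HasInterpolant.{u, v, w} V S := by
  cases b
  · exact ⟨.lab [] .bot, ⟨hS.nil_mem_shared, Fml.within_bot _⟩,
      fun M f _ _ => ⟨k, _, h, trivial⟩, fun M f _ h => h.elim⟩
  · exact ⟨.lab [] .top, ⟨hS.nil_mem_shared, Fml.within_top _⟩,
      fun M f _ h => (h trivial).elim, fun M f _ _ => ⟨k, _, h, trivial⟩⟩

/-- If both literals are on one side, that side is always true and a constant suffices. Otherwise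
the literal on the right side, at `k`, interpolates: by `ag_path` for both sides, all agents on `k`
are common. -/
theorem hasInterpolant_of_id (hS : S.WF V) {b c : Bool} {k : Path A} {p : P}
    (hp : (b, k, Fml.pos p) ∈ S.fml) (hn : (c, k, Fml.neg p) ∈ S.fml) :
    HasInterpolant.{u, v, w} V S := by
  have hp' := (hS.within _ _ _ hp).1 rfl
  have hn' := (hS.within _ _ _ hn).2.1 rfl
  have hsh : b ≠ c → k ∈ S.shared V := by
    intro hbc
    refine ⟨hS.mem_used _ _ _ hp, fun y hy => ?_⟩
    have h₁ := hS.ag_path _ _ _ hp y hy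
    have h₂ := hS.ag_path _ _ _ hn y hy
    cases b <;> cases c <;> first | exact ⟨h₁, h₂⟩ | exact ⟨h₂, h₁⟩ | exact absurd rfl hbc
  have hem : ∀ (M : Model.{u, v, w} P A) (f : Path A → M.World), b = c → S.Holds b M f := by
    rintro M f rfl
    by_cases h : M.Sat (f k) (.pos p)
    · exact ⟨k, _, hp, h⟩
    · exact ⟨k, _, hn, h⟩
  cases b <;> cases c
  · exact ⟨.lab [] .bot, ⟨hS.nil_mem_shared, Fml.within_bot _⟩,
      fun M f _ _ => hem M f rfl, fun M f _ h => h.elim⟩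
  · refine ⟨.lab k (.neg p), ⟨hsh (by simp), ?_⟩, fun M f _ h => ⟨k, _, hp, not_not.1 h⟩,
      fun M f _ h => ⟨k, _, hn, h⟩⟩
    exact ⟨Set.empty_subset _, Set.singleton_subset_iff.2 ⟨hp', hn'⟩, Set.empty_subset _⟩
  · refine ⟨.lab k (.pos p), ⟨hsh (by simp), ?_⟩, fun M f _ h => ⟨k, _, hn, h⟩,
      fun M f _ h => ⟨k, _, hp, h⟩⟩
    exact ⟨Set.singleton_subset_iff.2 ⟨hn', hp'⟩, Set.empty_subset _, Set.empty_subset _⟩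
  · exact ⟨.lab [] .top, ⟨hS.nil_mem_shared, Fml.within_top _⟩,
      fun M f _ h => (h trivial).elim, fun M f _ _ => hem M f rfl⟩

theorem hasInterpolant_of_or {b : Bool} {k : Path A} {φ ψ : Fml P A} (hk : k ∈ S.used)
    (h : (b, k, Fml.or φ ψ) ∈ S.fml)
    (ih : HasInterpolant.{u, v, w} V ((S.add b k ψ).add b k φ)) :
    HasInterpolant.{u, v, w} V S := by
  refine ih.of_holds ?_ fun M f c _ hc => ?_
  · rw [shared_add (Set.mem_insert_of_mem _ hk), shared_add hk]
  · rcases holds_add.1 hc with ⟨rfl, hs⟩ | hc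
    · exact ⟨k, _, h, .inl hs⟩
    · rcases holds_add.1 hc with ⟨rfl, hs⟩ | hc
      · exact ⟨k, _, h, .inr hs⟩
      · exact hc

/-- On the left, failure of the interpolant has to give both conjuncts, so a disjunction is needed;
on the right its truth has to, so a conjunction is. -/
theorem hasInterpolant_of_and {b : Bool} {k : Path A} {φ ψ : Fml P A} (hk : k ∈ S.used)
    (h : (b, k, Fml.and φ ψ) ∈ S.fml) (ih₁ : HasInterpolant.{u, v, w} V (S.add b k φ))
    (ih₂ : HasInterpolant.{u, v, w} V (S.add b k ψ)) : HasInterpolant.{u, v, w} V S := by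
  obtain ⟨m₁, o₁, l₁, r₁⟩ := ih₁
  obtain ⟨m₂, o₂, l₂, r₂⟩ := ih₂
  rw [shared_add hk] at o₁ o₂
  simp only [holds_add] at l₁ l₂ r₁ r₂
  cases b
  · refine ⟨.disj m₁ m₂, ⟨o₁, o₂⟩, fun M f hf hm => ?_, fun M f hf hm => ?_⟩
    · rcases l₁ M f hf (fun h => hm (.inl h)) with ⟨-, h₁⟩ | h₁
      · rcases l₂ M f hf (fun h => hm (.inr h)) with ⟨-, h₂⟩ | h₂
        · exact ⟨k, _, h, h₁, h₂⟩
        · exact h₂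
      · exact h₁
    · rcases hm with hm | hm
      · simpa using r₁ M f hf hm
      · simpa using r₂ M f hf hm
  · refine ⟨.conj m₁ m₂, ⟨o₁, o₂⟩, fun M f hf hm => ?_, fun M f hf hm => ?_⟩
    · rcases not_and_or.1 hm with hm | hm
      · simpa using l₁ M f hf hm
      · simpa using l₂ M f hf hm
    · rcases r₁ M f hf hm.1 with ⟨-, h₁⟩ | h₁
      · rcases r₂ M f hf hm.2 with ⟨-, h₂⟩ | h₂
        · exact ⟨k, _, h, h₁, h₂⟩
        · exact h₂
      · exact h₁

theorem hasInterpolant_of_dia {b : Bool} {k l : Path A} {a : A} {φ : Fml P A} (hl : l ∈ S.used)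
    (h : (b, k, Fml.dia a φ) ∈ S.fml)
    (hkl : ∀ (M : Model.{u, v, w} P A) (f : Path A → M.World), IsPathInterpretation M f →
      M.R a (f k) (f l))
    (ih : HasInterpolant.{u, v, w} V (S.add b l φ)) : HasInterpolant.{u, v, w} V S := by
  refine ih.of_holds (shared_add hl) fun M f c hf hc => ?_
  rcases holds_add.1 hc with ⟨rfl, hs⟩ | hc
  · exact ⟨k, _, h, f l, hkl M f hf, hs⟩
  · exact hc

/-- The path `k`, as an `a`-parent, and the path `x` are in the same `a`-cluster. -/
def Near (a : A) (k x : Path A) : Prop := x = k ∨ ∃ i, x = (a, i) :: k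

theorem Near.rel {a : A} {k x : Path A} (h : Near a k x) {M : Model.{u, v, w} P A}
    {f : Path A → M.World} (hf : IsPathInterpretation M f) : M.R a (f k) (f x) := by
  rcases h with rfl | ⟨i, rfl⟩
  · exact (M.equiv a).refl _
  · exact hf _ _ _

/-- This carries the invariant `ag_path` through the modal rules: `a` is in the vocabulary of the
principal formula's side. -/
theorem Near.ag_iff {a : A} {k x : Path A} (h : Near a k x) {s : Set A} (ha : a ∈ s) :
    (∀ y ∈ x, y.1 ∈ s) ↔ ∀ y ∈ k, y.1 ∈ s := by
  rcases h with rfl | ⟨i, rfl⟩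
  · rfl
  · simp [ha]

theorem WF.exists_fresh (hS : S.WF V) (a : A) (k : Path A) :
    ∃ i, ∀ x ∈ S.used, ¬ ((a, i) :: k) <:+ x := by
  obtain ⟨N, hN⟩ := hS.bounded
  exact ⟨N, fun x hx h => absurd (hN x hx (a, N) (h.subset List.mem_cons_self)) (lt_irrefl N)⟩

/-- The new path is fresh, so regrafting it to any `a`-successor `v` of `f k` leaves the formulas of
`S` unaffected. If side `b` of `S` fails, the premise makes `φ` true at all these `v`, hence the box
true at `x`. -/
theorem hasInterpolant_of_box [DecidableEq A] (hS : S.WF V) {b : Bool} {k x : Path A} {a : A}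
    {i : ℕ} {φ : Fml P A} (hk : k ∈ S.used) (hx : Near a k x) (h : (b, x, Fml.box a φ) ∈ S.fml)
    (hi : ∀ x ∈ S.used, ¬ ((a, i) :: k) <:+ x)
    (ih : HasInterpolant.{u, v, w} V (S.add b ((a, i) :: k) φ)) :
    HasInterpolant.{u, v, w} V S := by
  obtain ⟨m, o, l, r⟩ := ih
  -- transfer of truth along a change of the interpretation at the new path
  have hcongr : ∀ (M : Model.{u, v, w} P A) (f : Path A → M.World) v c,
      S.Holds c M (graft f ((a, i) :: k) v) → S.Holds c M f := by
    rintro M f v c ⟨k', φ', h', hs⟩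
    refine ⟨k', φ', h', ?_⟩
    rwa [graft, if_neg (hi k' (hS.mem_used _ _ _ h'))] at hs
  have hbox : ∀ (M : Model.{u, v, w} P A) (f : Path A → M.World), IsPathInterpretation M f →
      (∀ v, M.R a (f k) v → (S.add b ((a, i) :: k) φ).Holds b M (graft f ((a, i) :: k) v)) →
      S.Holds b M f := by
    intro M f hf hv
    by_contra hcon
    refine hcon ⟨x, _, h, fun v hxv => ?_⟩
    rcases holds_add.1 (hv v ((M.equiv a).trans (hx.rel hf) hxv)) with ⟨-, hs⟩ | hs
    · simpa [graft] using hs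
    · exact absurd (hcongr M f v b hs) hcon
  have hother : ∀ (M : Model.{u, v, w} P A) (f : Path A → M.World) v c, c ≠ b →
      (S.add b ((a, i) :: k) φ).Holds c M (graft f ((a, i) :: k) v) → S.Holds c M f := by
    intro M f v c hc hs
    exact hcongr M f v c ((holds_add.1 hs).resolve_left fun h => hc h.1)
  have hnil := hS.nil_mem_shared
  have hfresh : ∀ x ∈ S.shared V, ¬ ((a, i) :: k) <:+ x := fun x hx => hi x hx.1
  have hov : (S.add b ((a, i) :: k) φ).shared V ⊆ insert ((a, i) :: k) (S.shared V) := by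
    rintro x ⟨rfl | hx, hx'⟩
    · exact .inl rfl
    · exact .inr ⟨hx, hx'⟩
  by_cases hcom : ∀ y ∈ (a, i) :: k, y.1 ∈ (Vocab.common V).ag
  · have ha : a ∈ (Vocab.common V).ag := hcom _ List.mem_cons_self
    have hk' : k ∈ S.shared V := ⟨hk, fun y hy => hcom y (List.mem_cons_of_mem _ hy)⟩
    cases b
    · obtain ⟨m', o', hs'⟩ := PathFormula.exists_elim.{u, v, w} hnil hfresh hk' ha (o.mono hov)
      refine ⟨m', o', fun M f hf hm => hbox M f hf fun v hv => ?_, fun M f hf hm => ?_⟩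
      · exact l M _ (hf.graft hv) fun hm' => hm ((hs' M f).2 ⟨v, hv, hm'⟩)
      · obtain ⟨v, hv, hm'⟩ := (hs' M f).1 hm
        exact hother M f v _ (by simp) (r M _ (hf.graft hv) hm')
    -- Dual case: a universal quantifier over `v` is needed, obtained by eliminating the label from
    -- `m.not` and negating again.
    · obtain ⟨m', o', hs'⟩ := PathFormula.exists_elim.{u, v, w} (C := (Vocab.common V).dual)
        hnil hfresh hk' ha (o.mono hov).not
      refine ⟨m'.not, o'.not, fun M f hf hm => ?_, fun M f hf hm => hbox M f hf fun v hv => ?_⟩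
      · rw [PathFormula.sat_not, not_not] at hm
        obtain ⟨v, hv, hm'⟩ := (hs' M f).1 hm
        exact hother M f v _ (by simp) (l M _ (hf.graft hv) ((PathFormula.sat_not _ _ _).1 hm'))
      · rw [PathFormula.sat_not] at hm
        refine r M _ (hf.graft hv) (by_contra fun hm' => hm ((hs' M f).2 ⟨v, hv, ?_⟩))
        exact (PathFormula.sat_not _ _ _).2 hm'
  -- The new path is not shared, so `m` does not mention it and its truth does not depend on `v`.
  · have o' : m.Over (S.shared V) (Vocab.common V) := by
      refine o.mono ?_
      rintro x ⟨rfl | hx, hx'⟩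
      · exact absurd hx' hcom
      · exact ⟨hx, hx'⟩
    have hm : ∀ (M : Model.{u, v, w} P A) (f : Path A → M.World) v,
        m.Sat M (graft f ((a, i) :: k) v) ↔ m.Sat M f := fun M f v =>
      PathFormula.sat_congr M (fun x hx => if_neg (hfresh x hx)) o'
    have hall : ∀ c (M : Model.{u, v, w} P A) (f : Path A → M.World), IsPathInterpretation M f →
        (∀ v, M.R a (f k) v → (S.add b ((a, i) :: k) φ).Holds c M (graft f ((a, i) :: k) v)) →
        S.Holds c M f := by
      intro c M f hf hv
      by_cases hc : c = b
      · subst hc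
        exact hbox M f hf hv
      -- For the other side any single successor will do; reflexivity supplies `f k`.
      · exact hother M f (f k) c hc (hv _ ((M.equiv a).refl _))
    exact ⟨m, o',
      fun M f hf h => hall _ M f hf fun v hv => l M _ (hf.graft hv) fun h' => h ((hm M f v).1 h'),
      fun M f hf h => hall _ M f hf fun v hv => r M _ (hf.graft hv) ((hm M f v).2 h)⟩

end PathSequent

/-! ## Cross-sequents realised by path sequents -/

/-- The cross-sequent is realised in `S`, with its root component at the path `k`. -/
inductive Realises (S : PathSequent P A) : Path A → CrossSequent P A → Prop
  | node (k : Path A) (Δ : Sequent P A) (br : A → List (CrossSequent P A)) (hk : k ∈ S.used)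
      (hΔ : ∀ φ ∈ Δ, ∃ b, (b, k, φ) ∈ S.fml) (i : ∀ a, ∀ T ∈ br a, ℕ)
      (hbr : ∀ a T (hT : T ∈ br a), Realises S ((a, i a T hT) :: k) T) :
      Realises S k (.node Δ br)

namespace Realises

variable {S S' : PathSequent P A} {k : Path A}

theorem intro {Δ : Sequent P A} {br : A → List (CrossSequent P A)} (hk : k ∈ S.used)
    (hΔ : ∀ φ ∈ Δ, ∃ b, (b, k, φ) ∈ S.fml)
    (hbr : ∀ a, ∀ T ∈ br a, ∃ i, Realises S ((a, i) :: k) T) : Realises S k (.node Δ br) := by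
  choose i hi using hbr
  exact .node k Δ br hk hΔ i hi

theorem mem_used {T : CrossSequent P A} (h : Realises S k T) : k ∈ S.used := by
  cases h with | node _ _ _ hk => exact hk

theorem mem_fml {T : CrossSequent P A} (h : Realises S k T) {φ : Fml P A} (hφ : φ ∈ T.root) :
    ∃ b, (b, k, φ) ∈ S.fml := by
  cases h with | node _ _ _ _ hΔ => exact hΔ φ hφ

theorem bracket {T : CrossSequent P A} (h : Realises S k T) {a : A} {U : CrossSequent P A}
    (hU : U ∈ T.bracket a) : ∃ i, Realises S ((a, i) :: k) U := by
  cases h with | node _ _ _ _ _ i hbr => exact ⟨_, hbr a U hU⟩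

theorem mono (hS : S ≤ S') {T : CrossSequent P A} (h : Realises S k T) : Realises S' k T := by
  induction h with
  | node k Δ br hk hΔ i _ ih =>
    exact .node k Δ br (hS.1 hk) (fun φ hφ => (hΔ φ hφ).imp fun _ h => hS.2 h) i ih

theorem leaf (hk : k ∈ S.used) {b : Bool} {φ : Fml P A} (hφ : (b, k, φ) ∈ S.fml) :
    Realises S k (CTree.leaf {φ}) :=
  intro hk (fun ψ hψ => ⟨b, by rwa [Finset.mem_singleton.1 hψ]⟩) (by simp)

variable [DecidableEq A]

theorem update {Δ : Sequent P A} {br : A → List (CrossSequent P A)}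
    (h : Realises S k (.node Δ br)) {a : A} {H : List (CrossSequent P A)}
    (hH : ∀ T ∈ H, ∃ i, Realises S ((a, i) :: k) T) :
    Realises S k (.node Δ (Function.update br a H)) := by
  refine intro h.mem_used (fun φ hφ => h.mem_fml hφ) fun b T hT => ?_
  by_cases hb : b = a
  · subst hb
    rw [Function.update_self] at hT
    exact hH T hT
  · rw [Function.update_of_ne hb] at hT
    exact h.bracket hT

/-- Finds the path of the hole; since realisation is monotone, the context stays realised in every
extension, whatever is put in the hole at that path. -/
theorem fill {K : CTree.Ctx A (Sequent P A)} {T : CrossSequent P A}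
    (h : Realises S k (K.fill T)) :
    ∃ l, Realises S l T ∧ ∀ S', S ≤ S' → ∀ T', Realises S' l T' → Realises S' k (K.fill T') := by
  induction K generalizing k with
  | hole => exact ⟨k, h, fun _ _ _ h => h⟩
  | inside c br a H₁ K H₂ ih =>
    have hbr : ∀ {U}, U ∈ H₁ ++ K.fill T :: H₂ → ∃ i, Realises S ((a, i) :: k) U := fun hU =>
      h.bracket (a := a) (by simpa [CTree.Ctx.fill, CTree.bracket] using hU)
    obtain ⟨i, hi⟩ := hbr (U := K.fill T) (by simp)
    obtain ⟨l, hl, hfill⟩ := ih hi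
    refine ⟨l, hl, fun S' hS T' hT' => ?_⟩
    have h' := (h.mono hS).update (a := a) (H := H₁ ++ K.fill T' :: H₂) (by
      intro U hU
      rw [List.mem_append, List.mem_cons] at hU
      rcases hU with hU | rfl | hU
      · exact (hbr (by simp [hU])).imp fun _ h => h.mono hS
      · exact ⟨i, hfill S' hS T' hT'⟩
      · exact (hbr (by simp [hU])).imp fun _ h => h.mono hS)
    rwa [Function.update_idem] at h'

variable [DecidableEq P]

theorem insert {Δ : Sequent P A} {br : A → List (CrossSequent P A)}
    (h : Realises S k (.node Δ br)) {b : Bool} {φ : Fml P A} (hφ : (b, k, φ) ∈ S.fml) :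
    Realises S k (.node (insert φ Δ) br) := by
  refine intro h.mem_used (fun ψ hψ => ?_) fun b T hT => h.bracket hT
  rcases Finset.mem_insert.1 hψ with rfl | hψ
  · exact ⟨b, hφ⟩
  · exact h.mem_fml hψ

end Realises

-- Induction on derivations

section Rules

variable [DecidableEq A] [DecidableEq P] {V : Bool → Vocab P A}

open PathSequent in
/-- Every rule preserves the existence of interpolants. -/
theorem Rule.hasInterpolant {S : PathSequent P A} {k : Path A} {T : CrossSequent P A}
    {ps : List (CrossSequent P A)} (hr : Rule T ps) (hS : S.WF V) (hT : Realises S k T)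
    (ih : ∀ T' ∈ ps, ∀ S', S ≤ S' → S'.WF V → Realises S' k T' → HasInterpolant.{u, v, w} V S') :
    HasInterpolant.{u, v, w} V S := by
  have hk := hT.mem_used
  -- Common core of the three box rules: the new component is an `a`-child of `k`, whether the box
  -- is at `k` or at an `a`-child of it.
  have box : ∀ {x b a φ}, Near a k x →
      (b, x, Fml.box a φ) ∈ S.fml →
      (∀ S', S ≤ S' → S'.WF V → (∃ i, Realises S' ((a, i) :: k) (CTree.leaf {φ})) →
        HasInterpolant.{u, v, w} V S') → HasInterpolant.{u, v, w} V S := by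
    intro x b a φ hx h ih
    obtain ⟨i, hi⟩ := hS.exists_fresh a k
    obtain ⟨ha, hφ⟩ := Fml.within_box.1 (hS.within _ _ _ h)
    refine hasInterpolant_of_box hS hk hx h hi (ih _ (S.le_add _ _ _) (hS.add ?_ hφ)
      ⟨i, .leaf (Set.mem_insert _ _) (S.mem_add _ _ _)⟩)
    exact (Near.ag_iff (.inr ⟨i, rfl⟩) ha).2 ((hx.ag_iff ha).1 (hS.ag_path _ _ _ h))
  -- Common core of the four diamond rules: source `x` and target `y` lie in the `a`-cluster around
  -- the parent `k`.
  have dia : ∀ {x y b a φ}, Near a k x → Near a k y → y ∈ S.used →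
      (b, x, Fml.dia a φ) ∈ S.fml →
      (∀ S', S ≤ S' → S'.WF V → (b, y, φ) ∈ S'.fml → HasInterpolant.{u, v, w} V S') →
      HasInterpolant.{u, v, w} V S := by
    intro x y b a φ hx hy hyu h ih
    obtain ⟨ha, hφ⟩ := Fml.within_dia.1 (hS.within _ _ _ h)
    refine hasInterpolant_of_dia hyu h (fun M f hf => (M.equiv a).trans
      ((M.equiv a).symm (hx.rel hf)) (hy.rel hf)) (ih _ (S.le_add _ _ _) (hS.add ?_ hφ)
        (S.mem_add _ _ _))
    exact (hy.ag_iff ha).2 ((hx.ag_iff ha).1 (hS.ag_path _ _ _ h))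
  have addChild : ∀ {S' : PathSequent P A} {Δ br a b φ H₁ U H₂ i}, br a = H₁ ++ U :: H₂ →
      Realises S' k (.node Δ br) → Realises S' ((a, i) :: k) U → (b, (a, i) :: k, φ) ∈ S'.fml →
      Realises S' k (.node Δ (Function.update br a (H₁ ++ CrossSequent.add φ U :: H₂))) := by
    intro S' Δ br a b φ H₁ U H₂ i hbr h hU hφ
    refine h.update fun W hW => ?_
    rw [List.mem_append, List.mem_cons] at hW
    rcases hW with hW | rfl | hW
    · exact h.bracket (a := a) (by simp [CTree.bracket, hbr, hW])
    · cases U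
      exact ⟨i, hU.insert hφ⟩
    · exact h.bracket (a := a) (by simp [CTree.bracket, hbr, hW])
  cases hr with
  | id Δ br p hp hn =>
    obtain ⟨b, hb⟩ := hT.mem_fml hp
    obtain ⟨c, hc⟩ := hT.mem_fml hn
    exact hasInterpolant_of_id hS hb hc
  | top Δ br h =>
    obtain ⟨b, hb⟩ := hT.mem_fml h
    exact hasInterpolant_of_top hS hb
  | or Δ br φ ψ h =>
    obtain ⟨b, hb⟩ := hT.mem_fml h
    obtain ⟨hφ, hψ⟩ := Fml.within_or.1 (hS.within _ _ _ hb)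
    have hag := hS.ag_path _ _ _ hb
    have hle := le_trans' (S.le_add b k ψ) ((S.add b k ψ).le_add b k φ)
    refine hasInterpolant_of_or hk hb (ih _ List.mem_cons_self _ hle ((hS.add hag hψ).add hag hφ) ?_)
    exact ((hT.mono hle).insert (.inr (S.mem_add b k ψ))).insert (mem_add _ _ _ _)
  | and Δ br φ ψ h =>
    obtain ⟨b, hb⟩ := hT.mem_fml h
    obtain ⟨hφ, hψ⟩ := Fml.within_and.1 (hS.within _ _ _ hb)
    have hag := hS.ag_path _ _ _ hb
    exact hasInterpolant_of_and hk hb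
      (ih _ List.mem_cons_self _ (S.le_add _ _ _) (hS.add hag hφ)
        ((hT.mono (S.le_add _ _ _)).insert (S.mem_add _ _ _)))
      (ih _ (List.mem_cons_of_mem _ List.mem_cons_self) _ (S.le_add _ _ _) (hS.add hag hψ)
        ((hT.mono (S.le_add _ _ _)).insert (S.mem_add _ _ _)))
  | boxIn Δ br a φ U hU h =>
    obtain ⟨i, hi⟩ := hT.bracket hU
    obtain ⟨b, hb⟩ := hi.mem_fml h
    refine box (.inr ⟨i, rfl⟩) hb fun S' hle hS' hn =>
      ih _ List.mem_cons_self S' hle hS' ((hT.mono hle).update fun W hW => ?_)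
    rcases List.mem_cons.1 hW with rfl | hW
    · exact hn
    · exact (hT.mono hle).bracket hW
  | boxUp Δ br a φ h hbr =>
    obtain ⟨b, hb⟩ := hT.mem_fml h
    refine box (.inl rfl) hb fun S' hle hS' hn =>
      ih _ List.mem_cons_self S' hle hS' ((hT.mono hle).update fun W hW => ?_)
    rcases List.mem_cons.1 hW with rfl | hW
    · exact hn
    · exact (hT.mono hle).bracket hW
  | boxNew Δ br a φ h hbr =>
    obtain ⟨b, hb⟩ := hT.mem_fml h
    refine box (.inl rfl) hb fun S' hle hS' hn =>
      ih _ List.mem_cons_self S' hle hS' ((hT.mono hle).update fun W hW => ?_)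
    rw [List.mem_singleton.1 hW]
    exact hn
  | diaIn Δ br a φ H₁ H₂ W U hbr hW h =>
    obtain ⟨i, hi⟩ := hT.bracket (a := a) (U := U) (by simp [CTree.bracket, hbr])
    obtain ⟨j, hj⟩ := hT.bracket (a := a) (U := W) (by
      rw [List.mem_append] at hW
      simp only [CTree.bracket, hbr, List.mem_append, List.mem_cons]
      tauto)
    obtain ⟨b, hb⟩ := hj.mem_fml h
    exact dia (.inr ⟨j, rfl⟩) (.inr ⟨i, rfl⟩) hi.mem_used hb fun S' hle hS' hφ =>
      ih _ List.mem_cons_self S' hle hS' (addChild hbr (hT.mono hle) (hi.mono hle) hφ)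
  | diaUp Δ br a φ H₁ H₂ U hbr h =>
    obtain ⟨i, hi⟩ := hT.bracket (a := a) (U := U) (by simp [CTree.bracket, hbr])
    obtain ⟨b, hb⟩ := hT.mem_fml h
    exact dia (.inl rfl) (.inr ⟨i, rfl⟩) hi.mem_used hb fun S' hle hS' hφ =>
      ih _ List.mem_cons_self S' hle hS' (addChild hbr (hT.mono hle) (hi.mono hle) hφ)
  | diaT Δ br a φ h =>
    obtain ⟨b, hb⟩ := hT.mem_fml h
    exact dia (.inl rfl) (.inl rfl) hk hb fun S' hle hS' hφ =>
      ih _ List.mem_cons_self S' hle hS' ((hT.mono hle).insert hφ)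
  | diaDown Δ br a φ U hU h =>
    obtain ⟨i, hi⟩ := hT.bracket (a := a) hU
    obtain ⟨b, hb⟩ := hi.mem_fml h
    exact dia (.inr ⟨i, rfl⟩) (.inl rfl) hk hb fun S' hle hS' hφ =>
      ih _ List.mem_cons_self S' hle hS' ((hT.mono hle).insert hφ)

/-- The induction is over all `S`, because the premises are realised only in extensions of the given
one. -/
theorem Derivable.hasInterpolant {T : CrossSequent P A} (h : Derivable T) {S : PathSequent P A}
    (hS : S.WF V) {k : Path A} (hT : Realises S k T) :
    PathSequent.HasInterpolant.{u, v, w} V S := by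
  induction h generalizing S k with
  | step K T ps hrule _ _ ih =>
    obtain ⟨l, hl, hfill⟩ := hT.fill
    exact hrule.hasInterpolant hS hl fun T' hT' S' hle hS' hr =>
      ih T' hT' hS' (hfill S' hle T' hr)

end Rules

/-! ## Cross-sequents of depth zero -/

namespace CTree

variable {C D : Type*}

theorem bracket_eq_nil_of_depth_eq_zero [Fintype A] {T : CTree A C} (h : T.depth = 0) (a : A) :
    T.bracket a = [] := by
  cases T with
  | node c br =>
    have ha : bracketDepth (br a) = 0 := by
      have := Finset.le_sup (f := fun a => bracketDepth (br a)) (Finset.mem_univ a)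
      rw [depth] at h
      omega
    cases hb : br a with
    | nil => exact hb
    | cons T H =>
      rw [hb, bracketDepth] at ha
      omega

theorem components_leaf (c : C) : (leaf c : CTree A C).components = {c} := by
  ext d
  simp only [components, Set.mem_ofPred_eq, Set.mem_singleton_iff]
  constructor
  · rintro ⟨T, hT, rfl⟩
    cases hT with
    | refl => rfl
    | step _ _ a hT => exact absurd hT List.not_mem_nil
  · rintro rfl
    exact ⟨_, .refl _, rfl⟩

theorem map_leaf (f : C → D) (c : C) : map f (leaf c : CTree A C) = leaf (f c) := by
  simp [leaf, map, mapList]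

theorem eq_leaf_of_depth_map [Fintype A] {f : C → D} {T : CTree A C} (h : (map f T).depth = 0) :
    T = leaf T.root := by
  cases T with
  | node c br =>
    have : br = fun _ => [] := by
      funext a
      have ha := bracket_eq_nil_of_depth_eq_zero h a
      cases hb : br a with
      | nil => rfl
      | cons T H => simp [map, bracket, hb, mapList] at ha
    simp [leaf, root, this]

end CTree

end SharpS5

-- From paths back to labels

open SharpS5 in
theorem mainTheorem4 {P : Type u} {A : Type v} [DecidableEq P] [DecidableEq A]
    [Fintype A] (S : SharpS5.CrossSequent P A) (hS : SharpS5.Derivable S) (hd : S.depth = 0)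
    (X : SharpS5.Split P A) (hX : X.IsSplitOf S) :
    ∃ m : SharpS5.Multiformula P A, m.IsSALIP.{u, v, w} X := by
  obtain ⟨rfl, -, h0⟩ := hX
  have hX := CTree.eq_leaf_of_depth_map hd
  rcases hc : X.root with ⟨n, s⟩
  obtain rfl : n = 0 := by simpa [hc] using h0
  rw [hc] at hX
  subst hX
  have hmerge : Split.merge (CTree.leaf (0, s) : Split P A) = CTree.leaf (s.left ∪ s.right) :=
    CTree.map_leaf _ _
  rw [hmerge] at hS
  have hL : Split.L (CTree.leaf (0, s) : Split P A) = CTree.leaf (0, s.left) :=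
    CTree.map_leaf _ _
  have hR : Split.R (CTree.leaf (0, s) : Split P A) = CTree.leaf (0, s.right) :=
    CTree.map_leaf _ _
  let side : Bool → Sequent P A := fun b => if b then s.right else s.left
  -- With this choice, being within `Vocab.common V` is by definition conditions 3 and 4 on
  -- interpolants.
  let V : Bool → Vocab P A := fun b =>
    let Y : Labelled A (Sequent P A) := CTree.leaf (0, side b)
    ⟨Y.varPos, Y.varNeg, Y.ag⟩
  let G : PathSequent P A := ⟨{[]}, {t | t.2.1 = [] ∧ t.2.2 ∈ side t.1}⟩
  have hG : G.WF V := by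
    refine ⟨rfl, ⟨0, ?_⟩, ?_, ?_, ?_⟩
    · rintro x rfl y hy
      exact absurd hy List.not_mem_nil
    · rintro b k φ ⟨hk, -⟩
      exact hk
    · rintro b k φ ⟨hk, -⟩ y hy
      simp only at hk
      simp [hk] at hy
    · rintro b k φ ⟨-, hφ⟩
      have hc : (0, side b) ∈ (CTree.leaf (0, side b) : Labelled A (Sequent P A)).components := by
        rw [CTree.components_leaf]; rfl
      exact ⟨fun p hp => ⟨_, hc, φ, hφ, hp⟩, fun p hp => ⟨_, hc, φ, hφ, hp⟩,
        fun p hp => ⟨_, hc, φ, hφ, hp⟩⟩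
  have hreal : Realises G [] (CTree.leaf (s.left ∪ s.right)) := by
    refine .intro rfl (fun φ hφ => ?_) (by simp)
    rcases Finset.mem_union.1 hφ with hφ | hφ
    · exact ⟨false, rfl, hφ⟩
    · exact ⟨true, rfl, hφ⟩
  obtain ⟨m, ho, hl, hr⟩ := hS.hasInterpolant.{u, v, w} hG hreal
  -- Only the root path is used, so `m` amounts to the formula `m.forget` at the root.
  have ho' : m.Over {[]} (Vocab.common V) := ho.mono fun x hx => hx.1
  have hw := ho'.within_forget
  -- Paths other than the root carry nothing, so they may all go to the world of the root.
  have hint : ∀ (M : Model.{u, v, w} P A) (t : M.World), IsPathInterpretation M fun _ => t :=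
    fun M t _ a _ => (M.equiv a).refl t
  have hholds : ∀ (M : Model.{u, v, w} P A) (f : ℕ → M.World) (b : Bool),
      G.Holds b M (fun _ => f 0) →
      Labelled.Sat M f (CTree.leaf (0, side b) : Labelled A (Sequent P A)) := by
    rintro M f b ⟨k, φ, ⟨-, hφ⟩, hs⟩
    exact ⟨(0, side b), by rw [CTree.components_leaf]; rfl, φ, hφ, hs⟩
  refine ⟨.lab 0 m.forget, ⟨?_, ?_, ?_, ?_, ?_⟩, ?_⟩
  · rintro l rfl
    exact ⟨(0, s), by rw [CTree.components_leaf]; rfl, rfl⟩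
  · intro M f _ hm
    rw [hL]
    exact hholds M f false (hl M _ (hint M _) fun h => hm ((PathFormula.sat_forget M _ ho').2 h))
  · intro M f _ hm
    rw [hR]
    exact hholds M f true (hr M _ (hint M _) ((PathFormula.sat_forget M _ ho').1 hm))
  · rw [hL, hR]
    exact hw.1
  · rw [hL, hR]
    exact hw.2.1
  · rw [hL, hR]
    exact hw.2.2
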